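/- For $n \ge 3$, choose $n$ points independently and uniformly at random in the unit square $[0,1]^2$. Let $A$ be the least area among the $\binom n3$ triangles (degenerate ones included) whose vertices are three of the $n$ points, and let $\mu_n = \mathbb{E}[A]$. Then there are constants $c, C > 0$, not depending on $n$, such that $$\frac{c}{n^3} < \mu_n < \frac{C}{n^3} \qquad \text{for all } n \ge 3.$$ In particular, $\mu_n = \Theta(1/n^3)$. -/

import Mathlib

open MeasureTheory ProbabilityTheory

/-- The closed unit square in the plane. -/
def unitSquare : Set (ℝ × ℝ) := Set.Icc 0 1 ×ˢ Set.Icc 0 1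

/-- The area of the (possibly degenerate) triangle with vertices `p`, `q`, `r`: half the absolute
value of the cross product of the side vectors `q - p` and `r - p`. -/
noncomputable def triangleArea (p q r : ℝ × ℝ) : ℝ :=
  |(q.1 - p.1) * (r.2 - p.2) - (q.2 - p.2) * (r.1 - p.1)| / 2

/-- The least area among the `n.choose 3` triangles whose vertices are three of the `n` points `x`,
for `3 ≤ n`. The infimum runs over a finite index set, which is nonempty exactly
when `3 ≤ n`; there it is a minimum. -/
noncomputable def minTriangleArea {n : ℕ} (x : Fin n → ℝ × ℝ) : ℝ :=
  ⨅ t : {t : Fin n × Fin n × Fin n // t.1 < t.2.1 ∧ t.2.1 < t.2.2},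
    triangleArea (x t.1.1) (x t.1.2.1) (x t.1.2.2)

/-! Given `p` and `q`, the points `r` with `triangleArea p q r ≤ ε` form a strip about the line `pq`
of width of order `ε / dist q p`; both bounds come from this.

Lower bound. Since `1 / dist` is integrable in the plane, a fixed triple has area at most `ε` with
probability at most `64 * ε`. A union bound over at most `n ^ 3` triples, with `ε` of order `n⁻³`,
leaves probability at least `1 / 2` that the minimum is at least `ε`, and Markov's inequality
concludes.

Upper bound. Take `s` points for each of three separated vertical strips and count the triples in
`flatTriples ε`. Separation bounds the conditional probability of flatness given any two of the
points by `20 * ε`, so triples sharing one or two points have joint probability at most `(20 * ε) ^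
2`. With `ε` of order `s⁻³` the second moment method gives a flat triple with probability at least
`1 / 2` (`measure_forall_notMem_flatTriples_le`). To control the expectation, cut the `n` points
into `k` independent blocks: the minimum exceeds a constant times `k ^ 3 / n ^ 3` with probability
at most `2⁻ᵏ` (`measure_lt_minTriangleArea_le`), and `∑ (k + 1) ^ 3 * 2⁻ᵏ` converges. -/

/-- The uniform distribution on the unit square. -/
noncomputable abbrev squareMeasure : Measure (ℝ × ℝ) := volume.restrict unitSquare

/-! ### Uniform measure and triangle area -/

theorem squareMeasure_eq_prod :
    squareMeasure = ((volume : Measure ℝ).restrict (Set.Icc 0 1)).prod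
      ((volume : Measure ℝ).restrict (Set.Icc 0 1)) := by
  rw [Measure.prod_restrict, squareMeasure, unitSquare, Measure.volume_eq_prod]

theorem volume_unitSquare : volume unitSquare = 1 := by
  rw [unitSquare, Measure.volume_eq_prod, Measure.prod_prod]; simp

instance : IsProbabilityMeasure squareMeasure := ⟨by simp [squareMeasure, volume_unitSquare]⟩

theorem measurableSet_unitSquare : MeasurableSet unitSquare :=
  measurableSet_Icc.prod measurableSet_Icc

theorem measurable_triangleArea {α : Type*} [MeasurableSpace α] {f g h : α → ℝ × ℝ}
    (hf : Measurable f) (hg : Measurable g) (hh : Measurable h) :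
    Measurable fun a => triangleArea (f a) (g a) (h a) := by
  unfold triangleArea
  exact (Measurable.abs (by fun_prop)).div_const _

theorem triangleArea_nonneg (p q r : ℝ × ℝ) : 0 ≤ triangleArea p q r := by
  unfold triangleArea; positivity

theorem triangleArea_swap_left (p q r : ℝ × ℝ) : triangleArea q p r = triangleArea p q r := by
  unfold triangleArea
  rw [← abs_neg]
  congr 2
  ring

theorem triangleArea_swap_right (p q r : ℝ × ℝ) : triangleArea p r q = triangleArea p q r := by
  unfold triangleArea
  rw [← abs_neg]
  congr 2
  ring

theorem triangleArea_le_one {p q r : ℝ × ℝ} (hp : p ∈ unitSquare) (hq : q ∈ unitSquare)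
    (hr : r ∈ unitSquare) : triangleArea p q r ≤ 1 := by
  obtain ⟨⟨a, b⟩, c, d⟩ := hp
  obtain ⟨⟨a', b'⟩, c', d'⟩ := hq
  obtain ⟨⟨a'', b''⟩, c'', d''⟩ := hr
  have h1 : |(q.1 - p.1) * (r.2 - p.2)| ≤ 1 := by
    rw [abs_mul]
    exact mul_le_one₀ (abs_le.2 ⟨by linarith, by linarith⟩) (abs_nonneg _)
      (abs_le.2 ⟨by linarith, by linarith⟩)
  have h2 : |(q.2 - p.2) * (r.1 - p.1)| ≤ 1 := by
    rw [abs_mul]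
    exact mul_le_one₀ (abs_le.2 ⟨by linarith, by linarith⟩) (abs_nonneg _)
      (abs_le.2 ⟨by linarith, by linarith⟩)
  have h3 := abs_sub ((q.1 - p.1) * (r.2 - p.2)) ((q.2 - p.2) * (r.1 - p.1))
  unfold triangleArea
  linarith

/-! ### Measure of the strip of third vertices -/

theorem volume_setOf_abs_mul_sub_le {a : ℝ} (ha : a ≠ 0) (u c δ : ℝ) :
    volume {y : ℝ | |a * (y - u) - c| / 2 ≤ δ} ≤ ENNReal.ofReal (4 * δ / |a|) := by
  have ha' : 0 < |a| := abs_pos.2 ha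
  calc volume {y : ℝ | |a * (y - u) - c| / 2 ≤ δ}
      ≤ volume (Metric.closedBall (u + c / a) (2 * δ / |a|)) := by
        apply measure_mono
        intro y hy
        rw [Set.mem_ofPred_eq] at hy
        rw [Metric.mem_closedBall, Real.dist_eq, le_div_iff₀ ha', ← abs_mul]
        have : (y - (u + c / a)) * a = a * (y - u) - c := by field_simp; ring
        rw [this]; linarith
    _ = _ := by rw [Real.volume_closedBall]; congr 1; ring

/-- Fubini: for fixed abscissa the area is half the absolute value of an affine function of the
ordinate, with slope `q.1 - p.1`, so each section is a short interval. -/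
theorem squareMeasure_triangleArea_le_fst {p q : ℝ × ℝ} (h : q.1 - p.1 ≠ 0) (ε : ℝ) :
    squareMeasure {r | triangleArea p q r ≤ ε} ≤ ENNReal.ofReal (4 * ε / |q.1 - p.1|) := by
  have hm : MeasurableSet {r | triangleArea p q r ≤ ε} := measurableSet_le
    (measurable_triangleArea measurable_const measurable_const measurable_id) measurable_const
  rw [squareMeasure_eq_prod, Measure.prod_apply hm]
  refine (lintegral_mono (g := fun _ => ENNReal.ofReal (4 * ε / |q.1 - p.1|)) fun x => ?_).trans
    (by simp)
  refine (Measure.restrict_apply_le _ _).trans ?_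
  exact volume_setOf_abs_mul_sub_le h p.2 ((q.2 - p.2) * (x - p.1)) ε

theorem squareMeasure_triangleArea_le_snd {p q : ℝ × ℝ} (h : q.2 - p.2 ≠ 0) (ε : ℝ) :
    squareMeasure {r | triangleArea p q r ≤ ε} ≤ ENNReal.ofReal (4 * ε / |q.2 - p.2|) := by
  have hm : MeasurableSet {r | triangleArea p q r ≤ ε} := measurableSet_le
    (measurable_triangleArea measurable_const measurable_const measurable_id) measurable_const
  rw [squareMeasure_eq_prod, Measure.prod_apply_symm hm]
  refine (lintegral_mono (g := fun _ => ENNReal.ofReal (4 * ε / |q.2 - p.2|)) fun x => ?_).trans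
    (by simp)
  refine (Measure.restrict_apply_le _ _).trans ?_
  refine le_trans (le_of_eq ?_)
    (volume_setOf_abs_mul_sub_le h p.1 ((q.1 - p.1) * (x - p.2)) ε)
  congr 1
  ext y
  simp only [Set.mem_preimage, Set.mem_ofPred_eq, triangleArea]
  rw [abs_sub_comm]

/-! ### Flat triples across separated strips -/

/-- Triples of points, one in each of three separated vertical strips of the square, that span a
triangle of area at most `ε`. The first two points stay away from the horizontal sides. -/
def flatTriples (ε : ℝ) : Set ((ℝ × ℝ) × (ℝ × ℝ) × (ℝ × ℝ)) :=
  {t | t.1 ∈ Set.Icc (0 : ℝ) (1 / 5) ×ˢ Set.Icc (1 / 4 : ℝ) (3 / 4) ∧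
    t.2.1 ∈ Set.Icc (4 / 5 : ℝ) 1 ×ˢ Set.Icc (1 / 4 : ℝ) (3 / 4) ∧
    t.2.2.1 ∈ Set.Icc (2 / 5 : ℝ) (3 / 5) ∧ triangleArea t.1 t.2.1 t.2.2 ≤ ε}

theorem measurableSet_flatTriples (ε : ℝ) : MeasurableSet (flatTriples ε) := by
  refine ((measurableSet_Icc.prod measurableSet_Icc).preimage measurable_fst).inter
    (((measurableSet_Icc.prod measurableSet_Icc).preimage (by fun_prop)).inter
      ((measurableSet_Icc.preimage (by fun_prop)).inter (measurableSet_le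
        (measurable_triangleArea ?_ ?_ ?_) measurable_const))) <;> fun_prop

theorem squareMeasure_triangleArea_le_of_far {p q : ℝ × ℝ} {ε : ℝ} (hε : 0 ≤ ε)
    (h : 1 / 5 ≤ |q.1 - p.1|) :
    squareMeasure {r | triangleArea p q r ≤ ε} ≤ ENNReal.ofReal (20 * ε) := by
  have h0 : 0 < |q.1 - p.1| := by linarith
  refine (squareMeasure_triangleArea_le_fst (abs_pos.1 h0) ε).trans (ENNReal.ofReal_le_ofReal ?_)
  rw [div_le_iff₀ h0]
  nlinarith

/-- Points in different strips are at horizontal distance at least `1 / 5`. If `p` and `q` are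
closer than that, no `r` completes them. The next two lemmas do the same for the other vertices. -/
theorem squareMeasure_flatTriples_third_le {ε : ℝ} (hε : 0 ≤ ε) (p q : ℝ × ℝ) :
    squareMeasure {r | (p, q, r) ∈ flatTriples ε} ≤ ENNReal.ofReal (20 * ε) := by
  by_cases h : 1 / 5 ≤ |q.1 - p.1|
  · exact (measure_mono fun r hr => hr.2.2.2).trans (squareMeasure_triangleArea_le_of_far hε h)
  · refine le_trans (le_of_eq ?_) zero_le
    convert! measure_empty (μ := squareMeasure)
    refine Set.eq_empty_of_forall_notMem fun r hr => h ?_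
    obtain ⟨⟨⟨a, b⟩, -⟩, ⟨⟨c, d⟩, -⟩, -⟩ := hr
    exact le_abs.2 (Or.inl (by simp only at *; linarith))

theorem squareMeasure_flatTriples_second_le {ε : ℝ} (hε : 0 ≤ ε) (p r : ℝ × ℝ) :
    squareMeasure {q | (p, q, r) ∈ flatTriples ε} ≤ ENNReal.ofReal (20 * ε) := by
  by_cases h : 1 / 5 ≤ |r.1 - p.1|
  · refine (measure_mono fun q hq => ?_).trans (squareMeasure_triangleArea_le_of_far hε h)
    rw [Set.mem_ofPred_eq, triangleArea_swap_right]
    exact hq.2.2.2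
  · refine le_trans (le_of_eq ?_) zero_le
    convert! measure_empty (μ := squareMeasure)
    refine Set.eq_empty_of_forall_notMem fun q hq => h ?_
    obtain ⟨⟨⟨a, b⟩, -⟩, -, ⟨c, d⟩, -⟩ := hq
    exact le_abs.2 (Or.inl (by simp only at *; linarith))

theorem squareMeasure_flatTriples_first_le {ε : ℝ} (hε : 0 ≤ ε) (q r : ℝ × ℝ) :
    squareMeasure {p | (p, q, r) ∈ flatTriples ε} ≤ ENNReal.ofReal (20 * ε) := by
  by_cases h : 1 / 5 ≤ |r.1 - q.1|
  · refine (measure_mono fun p hp => ?_).trans (squareMeasure_triangleArea_le_of_far hε h)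
    rw [Set.mem_ofPred_eq, triangleArea_swap_right, triangleArea_swap_left]
    exact hp.2.2.2
  · refine le_trans (le_of_eq ?_) zero_le
    convert! measure_empty (μ := squareMeasure)
    refine Set.eq_empty_of_forall_notMem fun p hp => h ?_
    obtain ⟨-, ⟨⟨a, b⟩, -⟩, ⟨c, d⟩, -⟩ := hp
    exact le_abs.2 (Or.inr (by simp only at *; linarith))

/-- Over each abscissa of the middle strip the line `pq` has height `m` in `[1/4, 3/4]`, so the
interval of radius `2 * ε ≤ 1 / 4` about `m` stays in the square. All its points give area at most
`ε`, because `q.1 - p.1 ≤ 1`. -/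
theorem le_squareMeasure_flatTriples {ε : ℝ} (hε : 0 ≤ ε) (hε' : ε ≤ 1 / 8) {p q : ℝ × ℝ}
    (hp : p ∈ Set.Icc (0 : ℝ) (1 / 5) ×ˢ Set.Icc (1 / 4 : ℝ) (3 / 4))
    (hq : q ∈ Set.Icc (4 / 5 : ℝ) 1 ×ˢ Set.Icc (1 / 4 : ℝ) (3 / 4)) :
    ENNReal.ofReal (4 * ε / 5) ≤ squareMeasure {r | (p, q, r) ∈ flatTriples ε} := by
  have hm : MeasurableSet {r | (p, q, r) ∈ flatTriples ε} :=
    (measurableSet_flatTriples ε).preimage (by fun_prop)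
  rw [squareMeasure_eq_prod, Measure.prod_apply hm]
  obtain ⟨⟨hp1, hp1'⟩, hp2, hp2'⟩ := id hp
  obtain ⟨⟨hq1, hq1'⟩, hq2, hq2'⟩ := id hq
  have hd : 0 < q.1 - p.1 := by linarith
  calc ENNReal.ofReal (4 * ε / 5)
      = ∫⁻ x in Set.Icc (2 / 5 : ℝ) (3 / 5), ENNReal.ofReal (4 * ε) := by
        rw [setLIntegral_const, Real.volume_Icc, ← ENNReal.ofReal_mul (by positivity)]
        congr 1; ring
    _ ≤ ∫⁻ x in Set.Icc (2 / 5 : ℝ) (3 / 5), (volume.restrict (Set.Icc (0 : ℝ) 1))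
          (Prod.mk x ⁻¹' {r | (p, q, r) ∈ flatTriples ε}) := by
        refine setLIntegral_mono' measurableSet_Icc fun x hx => ?_
        set m := p.2 + (q.2 - p.2) * ((x - p.1) / (q.1 - p.1)) with hmdef
        set θ := (x - p.1) / (q.1 - p.1) with hθ
        have hθ0 : 0 ≤ θ := div_nonneg (by linarith [hx.1]) hd.le
        have hθ1 : θ ≤ 1 := (div_le_one hd).2 (by linarith [hx.2])
        have hθm : θ * (q.1 - p.1) = x - p.1 := div_mul_cancel₀ _ hd.ne'
        have hm1 : 1 / 4 ≤ m := by nlinarith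
        have hm2 : m ≤ 3 / 4 := by nlinarith
        rw [Measure.restrict_apply (hm.preimage (by fun_prop))]
        calc ENNReal.ofReal (4 * ε) = volume (Metric.closedBall m (2 * ε)) := by
              rw [Real.volume_closedBall]; congr 1; ring
          _ ≤ _ := by
            refine measure_mono fun y hy => ?_
            rw [Metric.mem_closedBall, Real.dist_eq] at hy
            have hy' := abs_le.1 hy
            refine ⟨⟨hp, hq, hx, ?_⟩, by constructor <;> linarith⟩
            simp only [triangleArea]
            have : (q.1 - p.1) * (y - p.2) - (q.2 - p.2) * (x - p.1) = (q.1 - p.1) * (y - m) := by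
              rw [← hθm, hmdef]; ring
            rw [this, abs_mul, abs_of_pos hd]
            nlinarith [abs_nonneg (y - m)]
    _ ≤ _ := by
        refine lintegral_mono' (Measure.restrict_mono ?_ le_rfl) le_rfl
        exact Set.Icc_subset_Icc (by norm_num) (by norm_num)

theorem squareMeasure_leftBox :
    squareMeasure (Set.Icc (0 : ℝ) (1 / 5) ×ˢ Set.Icc (1 / 4 : ℝ) (3 / 4)) =
      ENNReal.ofReal (1 / 10) := by
  rw [squareMeasure_eq_prod, Measure.prod_prod, Measure.restrict_apply measurableSet_Icc,
    Measure.restrict_apply measurableSet_Icc,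
    Set.inter_eq_left.2 (Set.Icc_subset_Icc (by norm_num) (by norm_num)),
    Set.inter_eq_left.2 (Set.Icc_subset_Icc (by norm_num) (by norm_num)), Real.volume_Icc,
    Real.volume_Icc, ← ENNReal.ofReal_mul (by norm_num)]
  norm_num

theorem squareMeasure_rightBox :
    squareMeasure (Set.Icc (4 / 5 : ℝ) 1 ×ˢ Set.Icc (1 / 4 : ℝ) (3 / 4)) =
      ENNReal.ofReal (1 / 10) := by
  rw [squareMeasure_eq_prod, Measure.prod_prod, Measure.restrict_apply measurableSet_Icc,
    Measure.restrict_apply measurableSet_Icc,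
    Set.inter_eq_left.2 (Set.Icc_subset_Icc (by norm_num) (by norm_num)),
    Set.inter_eq_left.2 (Set.Icc_subset_Icc (by norm_num) (by norm_num)), Real.volume_Icc,
    Real.volume_Icc, ← ENNReal.ofReal_mul (by norm_num)]
  norm_num

theorem squareMeasure_closedBall_le (p : ℝ × ℝ) {ρ : ℝ} (hρ : 0 ≤ ρ) :
    squareMeasure (Metric.closedBall p ρ) ≤ ENNReal.ofReal (4 * ρ ^ 2) := by
  refine (Measure.restrict_apply_le _ _).trans ?_
  rw [← closedBall_prod_same, Measure.volume_eq_prod, Measure.prod_prod, Real.volume_closedBall,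
    Real.volume_closedBall, ← ENNReal.ofReal_mul (by positivity)]
  exact ENNReal.ofReal_le_ofReal (by nlinarith)

/-- The distance on `ℝ × ℝ` is the sup distance, hence equals one of the two coordinate differences.
-/
theorem squareMeasure_triangleArea_le_dist {p q : ℝ × ℝ} (h : p ≠ q) (ε : ℝ) :
    squareMeasure {r | triangleArea p q r ≤ ε} ≤ ENNReal.ofReal (4 * ε / dist q p) := by
  have hpos : 0 < dist q p := dist_pos.2 h.symm
  rw [Prod.dist_eq, Real.dist_eq, Real.dist_eq] at hpos ⊢
  rcases max_choice |q.1 - p.1| |q.2 - p.2| with h1 | h1 <;> rw [h1] at hpos ⊢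
  · exact squareMeasure_triangleArea_le_fst (abs_pos.1 hpos) ε
  · exact squareMeasure_triangleArea_le_snd (abs_pos.1 hpos) ε

/-! ### Independence and the second moment method -/

namespace ProbabilityTheory

variable {Ω α β : Type*} [MeasurableSpace Ω] [MeasurableSpace α] [MeasurableSpace β]
  {P : Measure Ω} [IsProbabilityMeasure P]

theorem IndepFun.measure_and_eq_setLIntegral {U : Ω → α} {V : Ω → β} (hUV : IndepFun U V P)
    (hU : Measurable U) (hV : Measurable V) {F : Set α} {E : Set (α × β)} (hF : MeasurableSet F)
    (hE : MeasurableSet E) :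
    P {ω | U ω ∈ F ∧ (U ω, V ω) ∈ E} = ∫⁻ u in F, P.map V {v | (u, v) ∈ E} ∂(P.map U) := by
  have hFE : MeasurableSet (Prod.fst ⁻¹' F ∩ E) := (hF.preimage measurable_fst).inter hE
  have := Measure.isProbabilityMeasure_map (μ := P) hV.aemeasurable
  have := Measure.isProbabilityMeasure_map (μ := P) hU.aemeasurable
  have h1 : P {ω | U ω ∈ F ∧ (U ω, V ω) ∈ E} =
      P.map (fun ω => (U ω, V ω)) (Prod.fst ⁻¹' F ∩ E) := by
    rw [Measure.map_apply (hU.prodMk hV) hFE]; rfl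
  rw [h1, (indepFun_iff_map_prod_eq_prod_map_map hU.aemeasurable hV.aemeasurable).1 hUV,
    Measure.prod_apply hFE, ← lintegral_indicator hF]
  refine lintegral_congr fun u => ?_
  by_cases hu : u ∈ F
  · rw [Set.indicator_of_mem hu]
    congr 1
    ext v
    simp [hu]
  · rw [Set.indicator_of_notMem hu]
    convert! measure_empty (μ := P.map V)
    ext v
    simp [hu]

theorem IndepFun.measure_and_le {U : Ω → α} {V : Ω → β} (hUV : IndepFun U V P)
    (hU : Measurable U) (hV : Measurable V) {F : Set α} {E : Set (α × β)} (hF : MeasurableSet F)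
    (hE : MeasurableSet E) {b : ENNReal} (h : ∀ u ∈ F, P.map V {v | (u, v) ∈ E} ≤ b) :
    P {ω | U ω ∈ F ∧ (U ω, V ω) ∈ E} ≤ b * P {ω | U ω ∈ F} := by
  rw [hUV.measure_and_eq_setLIntegral hU hV hF hE]
  refine (setLIntegral_mono' hF h).trans (le_of_eq ?_)
  rw [setLIntegral_const, Measure.map_apply hU hF]
  rfl

theorem IndepFun.le_measure_and {U : Ω → α} {V : Ω → β} (hUV : IndepFun U V P)
    (hU : Measurable U) (hV : Measurable V) {F : Set α} {E : Set (α × β)} (hF : MeasurableSet F)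
    (hE : MeasurableSet E) {b : ENNReal} (h : ∀ u ∈ F, b ≤ P.map V {v | (u, v) ∈ E}) :
    b * P {ω | U ω ∈ F} ≤ P {ω | U ω ∈ F ∧ (U ω, V ω) ∈ E} := by
  rw [hUV.measure_and_eq_setLIntegral hU hV hF hE]
  refine le_trans (le_of_eq ?_) (setLIntegral_mono' hF h)
  rw [setLIntegral_const, Measure.map_apply hU hF]
  rfl

theorem iIndepFun.indepFun_triple {P : Measure Ω} {ι : Type*} [DecidableEq ι]
    {X : ι → Ω → α} (hX : iIndepFun X P) (hm : ∀ i, Measurable (X i))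
    {i j l i' j' l' : ι} (hd : Disjoint ({i, j, l} : Finset ι) {i', j', l'}) :
    IndepFun (fun ω => (X i ω, X j ω, X l ω)) (fun ω => (X i' ω, X j' ω, X l' ω)) P := by
  have hind := hX.indepFun_finset _ _ hd hm
  let φ : (({i, j, l} : Finset ι) → α) → α × α × α := fun u =>
    (u ⟨i, by simp⟩, u ⟨j, by simp⟩, u ⟨l, by simp⟩)
  let ψ : (({i', j', l'} : Finset ι) → α) → α × α × α := fun u =>
    (u ⟨i', by simp⟩, u ⟨j', by simp⟩, u ⟨l', by simp⟩)
  exact hind.comp (φ := φ) (ψ := ψ) (by fun_prop) (by fun_prop)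

variable {ι : Type*} [Fintype ι] [DecidableEq ι] {X : ι → Ω → α}

/-- Condition on every variable except `X l`: the event `E'` is then decided, and `E` has
conditional probability at most `b`. -/
theorem iIndepFun.measure_and_le_mul (hX : iIndepFun X P) (hm : ∀ i, Measurable (X i))
    {E E' : Set (α × α × α)} (hE : MeasurableSet E) (hE' : MeasurableSet E') {b : ENNReal}
    {i j l i' j' l' : ι} (h : ∀ p q, P.map (X l) {r | (p, q, r) ∈ E} ≤ b)
    (hi : i ≠ l) (hj : j ≠ l) (hi' : i' ≠ l) (hj' : j' ≠ l) (hl' : l' ≠ l) :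
    P {ω | (X i ω, X j ω, X l ω) ∈ E ∧ (X i' ω, X j' ω, X l' ω) ∈ E'} ≤
      b * P {ω | (X i' ω, X j' ω, X l' ω) ∈ E'} := by
  have hind := hX.indepFun_finset (Finset.univ.erase l) {l} (by simp) hm
  let φ : (↥(Finset.univ.erase l : Finset ι) → α) → (α × α) × (α × α × α) := fun u =>
    ((u ⟨i, by simp [hi]⟩, u ⟨j, by simp [hj]⟩),
      (u ⟨i', by simp [hi']⟩, u ⟨j', by simp [hj']⟩, u ⟨l', by simp [hl']⟩))
  let ψ : (({l} : Finset ι) → α) → α := fun v => v ⟨l, by simp⟩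
  have hφ : Measurable φ := by fun_prop
  have hψ : Measurable ψ := by fun_prop
  have h1 := hind.comp hφ hψ
  have h2 := IndepFun.measure_and_le (F := Prod.snd ⁻¹' E')
    (E := {w | (w.1.1.1, w.1.1.2, w.2) ∈ E}) h1
    (hφ.comp (measurable_pi_lambda _ fun _ => hm _))
    (hψ.comp (measurable_pi_lambda _ fun _ => hm _)) (hE'.preimage measurable_snd)
    (hE.preimage (by fun_prop)) (b := b) (fun u _ => h u.1.1 u.1.2)
  refine le_trans (measure_mono ?_) h2
  exact fun ω hω => ⟨hω.2, hω.1⟩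

theorem iIndepFun.measure_mem_le (hX : iIndepFun X P) (hm : ∀ i, Measurable (X i))
    {E : Set (α × α × α)} (hE : MeasurableSet E) {b : ENNReal}
    {i j l : ι} (h : ∀ p q, P.map (X l) {r | (p, q, r) ∈ E} ≤ b)
    (hi : i ≠ l) (hj : j ≠ l) : P {ω | (X i ω, X j ω, X l ω) ∈ E} ≤ b := by
  have h1 := hX.measure_and_le_mul hm hE MeasurableSet.univ (b := b) (i := i) (j := j) (l := l)
    (i' := i) (j' := i) (l' := i) h hi hj hi hi hi
  simpa using h1

theorem iIndepFun.measure_forall_block_le {κ τ : Type*} [Fintype κ] [Fintype τ] [DecidableEq κ]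
    [DecidableEq τ] {X : κ × τ → Ω → α} (hX : iIndepFun X P) (hm : ∀ i, Measurable (X i))
    {D : Set (τ → α)} (hD : MeasurableSet D) {b : ENNReal}
    (h : ∀ g, P {ω | (fun t => X (g, t) ω) ∈ D} ≤ b) (S : Finset κ) :
    P {ω | ∀ g ∈ S, (fun t => X (g, t) ω) ∈ D} ≤ b ^ S.card := by
  induction S using Finset.induction with
  | empty => simp
  | insert g S hg ih =>
    have hind := hX.indepFun_finset ({g} ×ˢ Finset.univ) (S ×ˢ Finset.univ)
      (Finset.disjoint_product.2 (Or.inl (by simpa using hg))) hm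
    let A : Set ((({g} : Finset κ) ×ˢ (Finset.univ : Finset τ) : Finset (κ × τ)) → α) :=
      (fun u (t : τ) => u ⟨(g, t), by simp⟩) ⁻¹' D
    let B : Set ((S ×ˢ (Finset.univ : Finset τ) : Finset (κ × τ)) → α) :=
      ⋂ g' : S, (fun u (t : τ) => u ⟨(g', t), by simp⟩) ⁻¹' D
    have hA : MeasurableSet A := hD.preimage (by fun_prop)
    have hB : MeasurableSet B := MeasurableSet.iInter fun g' => hD.preimage (by fun_prop)
    have key := hind.measure_inter_preimage_eq_mul A B hA hB
    have e1 : {ω | ∀ g' ∈ insert g S, (fun t => X (g', t) ω) ∈ D} =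
        (fun a (i : ({g} ×ˢ Finset.univ : Finset (κ × τ))) => X i a) ⁻¹' A ∩
        (fun a (i : (S ×ˢ Finset.univ : Finset (κ × τ))) => X i a) ⁻¹' B := by
      ext ω
      simp [A, B]
    have e2 : (fun a (i : (S ×ˢ Finset.univ : Finset (κ × τ))) => X i a) ⁻¹' B =
        {ω | ∀ g ∈ S, (fun t => X (g, t) ω) ∈ D} := by
      ext ω
      simp [B]
    rw [e1, key, e2, Finset.card_insert_of_notMem hg, pow_succ']
    exact mul_le_mul' (h g) ih

theorem covariance_indicator_one {A B : Set Ω} (hA : MeasurableSet A) (hB : MeasurableSet B) :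
    cov[A.indicator (1 : Ω → ℝ), B.indicator (1 : Ω → ℝ); P] =
      P.real (A ∩ B) - P.real A * P.real B := by
  have hmem : ∀ {C : Set Ω}, MeasurableSet C → MemLp (C.indicator (1 : Ω → ℝ)) 2 P := fun hC =>
    memLp_indicator_const 2 hC (1 : ℝ) (Or.inr (measure_ne_top _ _))
  rw [covariance_eq_sub (hmem hA) (hmem hB), ← Set.inter_indicator_one, integral_indicator_one hA,
    integral_indicator_one hB, integral_indicator_one (hA.inter hB)]

/-- Second moment method. -/
theorem measureReal_iInter_compl_le {τ : Type*} [Fintype τ] {A : τ → Set Ω}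
    (hA : ∀ t, MeasurableSet (A t)) {c : τ → τ → ℝ} {e : ℝ} (he : 0 < e)
    (hle : e ≤ ∑ t, P.real (A t))
    (hc : ∀ t t', P.real (A t ∩ A t') - P.real (A t) * P.real (A t') ≤ c t t') :
    P.real (⋂ t, (A t)ᶜ) ≤ (∑ t, ∑ t', c t t') / e ^ 2 := by
  have hmem : ∀ t, MemLp ((A t).indicator (1 : Ω → ℝ)) 2 P := fun t =>
    memLp_indicator_const 2 (hA t) (1 : ℝ) (Or.inr (measure_ne_top _ _))
  set N : Ω → ℝ := fun ω => ∑ t, (A t).indicator (1 : Ω → ℝ) ω with hN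
  have hNm : MemLp N 2 P := memLp_finsetSum _ fun t _ => hmem t
  have hEN : ∫ ω, N ω ∂P = ∑ t, P.real (A t) := by
    rw [hN, integral_finsetSum _ fun t _ => (hmem t).integrable (by norm_num)]
    exact Finset.sum_congr rfl fun t _ => integral_indicator_one (hA t)
  have hvar : Var[N; P] ≤ ∑ t, ∑ t', c t t' := by
    rw [← covariance_self hNm.aestronglyMeasurable.aemeasurable, hN,
      covariance_fun_sum_fun_sum hmem hmem]
    refine Finset.sum_le_sum fun t _ => Finset.sum_le_sum fun t' _ => ?_
    rw [covariance_indicator_one (hA t) (hA t')]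
    exact hc t t'
  have hcheb := meas_ge_le_variance_div_sq hNm he
  have h1 : P (⋂ t, (A t)ᶜ) ≤ ENNReal.ofReal (Var[N; P] / e ^ 2) := by
    refine (measure_mono fun ω hω => ?_).trans hcheb
    have h0 : N ω = 0 := Finset.sum_eq_zero fun t _ =>
      Set.indicator_of_notMem (Set.mem_iInter.1 hω t) _
    rw [Set.mem_ofPred_eq, h0, hEN, zero_sub, abs_neg]
    exact hle.trans (le_abs_self _)
  have h2 : P.real (⋂ t, (A t)ᶜ) ≤ Var[N; P] / e ^ 2 :=
    ENNReal.toReal_le_of_le_ofReal (div_nonneg (variance_nonneg _ _) (by positivity)) h1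
  exact h2.trans (by gcongr)

end ProbabilityTheory

/-! ### Existence of a flat triple among uniform points -/

section UniformPoints

variable {Ω : Type*} [MeasurableSpace Ω] {P : Measure Ω} [IsProbabilityMeasure P]

theorem le_measure_mem_flatTriples {ι : Type*} {X : ι → Ω → ℝ × ℝ} (hX : iIndepFun X P)
    (hm : ∀ i, Measurable (X i)) (hlaw : ∀ i, P.map (X i) = squareMeasure) {ε : ℝ} (hε : 0 ≤ ε)
    (hε' : ε ≤ 1 / 8) {i j l : ι} (hij : i ≠ j) (hil : i ≠ l) (hjl : j ≠ l) :
    ENNReal.ofReal (ε / 125) ≤ P {ω | (X i ω, X j ω, X l ω) ∈ flatTriples ε} := by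
  set L := Set.Icc (0 : ℝ) (1 / 5) ×ˢ Set.Icc (1 / 4 : ℝ) (3 / 4) with hL
  set R := Set.Icc (4 / 5 : ℝ) 1 ×ˢ Set.Icc (1 / 4 : ℝ) (3 / 4) with hR
  have hLm : MeasurableSet L := measurableSet_Icc.prod measurableSet_Icc
  have hRm : MeasurableSet R := measurableSet_Icc.prod measurableSet_Icc
  have h1 : P {ω | (X i ω, X j ω) ∈ L ×ˢ R} = ENNReal.ofReal (1 / 100) := by
    have := (hX.indepFun hij).measure_inter_preimage_eq_mul L R hLm hRm
    rw [← Measure.map_apply (hm i) hLm, ← Measure.map_apply (hm j) hRm, hlaw, hlaw, hL, hR,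
      squareMeasure_leftBox, squareMeasure_rightBox, ← ENNReal.ofReal_mul (by norm_num)] at this
    rw [show (1 / 100 : ℝ) = 1 / 10 * (1 / 10) by norm_num]
    exact this
  have h2 := (hX.indepFun_prodMk hm i j l hil hjl).le_measure_and ((hm i).prodMk (hm j)) (hm l)
    (hLm.prod hRm) (E := {w | (w.1.1, w.1.2, w.2) ∈ flatTriples ε})
    ((measurableSet_flatTriples ε).preimage (by fun_prop)) (b := ENNReal.ofReal (4 * ε / 5))
    (fun u hu => by rw [hlaw]; exact le_squareMeasure_flatTriples hε hε' hu.1 hu.2)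
  calc ENNReal.ofReal (ε / 125)
      = ENNReal.ofReal (4 * ε / 5) * P {ω | (X i ω, X j ω) ∈ L ×ˢ R} := by
        rw [h1, ← ENNReal.ofReal_mul (by positivity)]; congr 1; ring
    _ ≤ _ := h2
    _ ≤ _ := measure_mono fun ω hω => hω.2

/-- The triples differ in some role, and the point of the first triple in that role does not occur
in the second. Integrating it out gives one factor `20 * ε`; the second triple gives the other. -/
theorem measure_mem_flatTriples_and_le {ι : Type*} [Fintype ι] [DecidableEq ι]
    {X : ι → Ω → ℝ × ℝ} (hX : iIndepFun X P)
    (hm : ∀ i, Measurable (X i)) (hlaw : ∀ i, P.map (X i) = squareMeasure) {ε : ℝ} (hε : 0 ≤ ε)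
    {i j l i' j' l' : ι} (hij : i ≠ j) (hil : i ≠ l) (hjl : j ≠ l)
    (hil' : i' ≠ l') (hjl' : j' ≠ l') (h1 : i ≠ j') (h2 : i ≠ l') (h3 : j ≠ i')
    (h4 : j ≠ l') (h5 : l ≠ i') (h6 : l ≠ j') (hne : i ≠ i' ∨ j ≠ j' ∨ l ≠ l') :
    P {ω | (X i ω, X j ω, X l ω) ∈ flatTriples ε ∧ (X i' ω, X j' ω, X l' ω) ∈ flatTriples ε} ≤
      ENNReal.ofReal (20 * ε) * ENNReal.ofReal (20 * ε) := by
  have hE := measurableSet_flatTriples ε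
  have hsingle : P {ω | (X i' ω, X j' ω, X l' ω) ∈ flatTriples ε} ≤ ENNReal.ofReal (20 * ε) :=
    hX.measure_mem_le hm hE
      (fun p q => by rw [hlaw]; exact squareMeasure_flatTriples_third_le hε p q) hil' hjl'
  refine le_trans ?_ (mul_le_mul' le_rfl hsingle)
  rcases hne with h | h | h
  · exact hX.measure_and_le_mul hm (E := {w | (w.2.2, w.1, w.2.1) ∈ flatTriples ε})
      (hE.preimage (by fun_prop)) hE
      (fun p q => by rw [hlaw]; exact squareMeasure_flatTriples_first_le hε p q)
      hij.symm hil.symm h.symm h1.symm h2.symm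
  · exact hX.measure_and_le_mul hm (E := {w | (w.1, w.2.2, w.2.1) ∈ flatTriples ε})
      (hE.preimage (by fun_prop)) hE
      (fun p q => by rw [hlaw]; exact squareMeasure_flatTriples_second_le hε p q)
      hij hjl.symm h3.symm h.symm h4.symm
  · exact hX.measure_and_le_mul hm hE hE
      (fun p q => by rw [hlaw]; exact squareMeasure_flatTriples_third_le hε p q)
      hil hjl h5.symm h6.symm h.symm

/-- Here `s ^ 3 * ε = 1250000`, so the mean count is at least `10 ^ 4`. The variance is at most `2.5
* 10 ^ 7` from the diagonal plus `1.875 * 10 ^ 15 / s` from triples sharing a point; `s ≥ 75000000`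
makes the total at most half of `(10 ^ 4) ^ 2`. -/
theorem measure_forall_notMem_flatTriples_le {s : ℕ} (hs : 75000000 ≤ s)
    {X : Fin 3 × Fin s → Ω → ℝ × ℝ} (hX : iIndepFun X P) (hm : ∀ i, Measurable (X i))
    (hlaw : ∀ i, P.map (X i) = squareMeasure) :
    P {ω | ∀ i j l, (X (0, i) ω, X (1, j) ω, X (2, l) ω) ∉
      flatTriples (1250000 / (s : ℝ) ^ 3)} ≤ ENNReal.ofReal (1 / 2) := by
  have hsR : (75000000 : ℝ) ≤ s := by exact_mod_cast hs
  have hs0 : (0 : ℝ) < s := by linarith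
  set ε : ℝ := 1250000 / (s : ℝ) ^ 3 with hεdef
  have hε : 0 < ε := by positivity
  have hsε : (s : ℝ) ^ 3 * ε = 1250000 := by rw [hεdef]; field_simp
  have hε' : ε ≤ 1 / 8 := by
    rw [hεdef, div_le_iff₀ (by positivity)]
    have : (75000000 : ℝ) ^ 3 ≤ (s : ℝ) ^ 3 := by gcongr
    linarith
  let A : Fin s × Fin s × Fin s → Set Ω := fun t =>
    {ω | (X (0, t.1) ω, X (1, t.2.1) ω, X (2, t.2.2) ω) ∈ flatTriples ε}
  have hA : ∀ t, MeasurableSet (A t) := fun t =>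
    (measurableSet_flatTriples ε).preimage ((hm _).prodMk ((hm _).prodMk (hm _)))
  have hlow : ∀ t, ε / 125 ≤ P.real (A t) := fun t => by
    rw [Measure.real, ← ENNReal.ofReal_le_iff_le_toReal (measure_ne_top _ _)]
    exact le_measure_mem_flatTriples hX hm hlaw hε.le hε' (by simp) (by simp) (by simp)
  have hup : ∀ t, P.real (A t) ≤ 20 * ε := fun t =>
    ENNReal.toReal_le_of_le_ofReal (by positivity) (hX.measure_mem_le hm
      (measurableSet_flatTriples ε)
      (fun p q => by rw [hlaw]; exact squareMeasure_flatTriples_third_le hε.le p q)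
      (by simp) (by simp))
  have hpair : ∀ t t', t ≠ t' → P.real (A t ∩ A t') ≤ (20 * ε) ^ 2 := fun t t' ht => by
    refine ENNReal.toReal_le_of_le_ofReal (by positivity) ?_
    rw [sq, ENNReal.ofReal_mul (by positivity)]
    refine measure_mem_flatTriples_and_le hX hm hlaw hε.le (by simp) (by simp) (by simp) (by simp)
      (by simp) (by simp) (by simp) (by simp) (by simp) (by simp) (by simp) ?_
    by_contra! hcon
    exact ht (by simpa [Prod.ext_iff] using hcon)
  have hind : ∀ t t', t.1 ≠ t'.1 → t.2.1 ≠ t'.2.1 → t.2.2 ≠ t'.2.2 →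
      P.real (A t ∩ A t') = P.real (A t) * P.real (A t') := fun t t' h1 h2 h3 => by
    have hd : Disjoint ({(0, t.1), (1, t.2.1), (2, t.2.2)} : Finset (Fin 3 × Fin s))
        {(0, t'.1), (1, t'.2.1), (2, t'.2.2)} := by
      simp [h1.symm, h2.symm, h3.symm]
    have := (hX.indepFun_triple hm hd).measure_inter_preimage_eq_mul _ _
      (measurableSet_flatTriples ε) (measurableSet_flatTriples ε)
    rw [Measure.real, Measure.real, Measure.real, ← ENNReal.toReal_mul]
    exact congrArg _ this
  -- Covariance bound: `20 * ε` on the diagonal, `(20 * ε) ^ 2` for each shared index, and zero for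
  -- disjoint triples, which are independent.
  let c : Fin s × Fin s × Fin s → Fin s × Fin s × Fin s → ℝ := fun t t' =>
    (if t = t' then 20 * ε else 0) + (if t.1 = t'.1 then (20 * ε) ^ 2 else 0) +
      (if t.2.1 = t'.2.1 then (20 * ε) ^ 2 else 0) + (if t.2.2 = t'.2.2 then (20 * ε) ^ 2 else 0)
  have hc : ∀ t t', P.real (A t ∩ A t') - P.real (A t) * P.real (A t') ≤ c t t' := fun t t' => by
    have hnn : 0 ≤ P.real (A t) * P.real (A t') := by positivity
    have hb : 0 ≤ 20 * ε := by positivity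
    have hb2 : 0 ≤ (20 * ε) ^ 2 := by positivity
    have hite : ∀ (q : Prop) [Decidable q] (x : ℝ), 0 ≤ x → 0 ≤ if q then x else 0 :=
      fun q _ x hx => by split_ifs <;> simp [hx]
    have e1 := hite (t = t') _ hb
    have e2 := hite (t.1 = t'.1) _ hb2
    have e3 := hite (t.2.1 = t'.2.1) _ hb2
    have e4 := hite (t.2.2 = t'.2.2) _ hb2
    simp only [c]
    by_cases h0 : t = t'
    · subst h0
      rw [Set.inter_self]
      have := hup t
      rw [if_pos rfl]
      linarith
    have hp := hpair t t' h0
    by_cases h1 : t.1 = t'.1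
    · rw [if_pos h1]; linarith
    by_cases h2 : t.2.1 = t'.2.1
    · rw [if_pos h2]; linarith
    by_cases h3 : t.2.2 = t'.2.2
    · rw [if_pos h3]; linarith
    rw [hind t t' h1 h2 h3]
    linarith
  have hsum : ∑ t, ∑ t', c t t' = (s : ℝ) ^ 3 * (20 * ε) + 3 * (s : ℝ) ^ 5 * (20 * ε) ^ 2 := by
    have e1 : ∀ (a : Fin s) (x : ℝ),
        ∑ t : Fin s × Fin s × Fin s, (if a = t.1 then x else 0) = (s : ℝ) ^ 2 * x :=
      fun a x => by
        rw [Fintype.sum_prod_type_right]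
        simp only [Finset.sum_ite_eq, Finset.mem_univ, if_true, Finset.sum_const, Finset.card_univ,
          Fintype.card_prod, Fintype.card_fin, nsmul_eq_mul]
        push_cast; ring
    have e2 : ∀ (a : Fin s) (x : ℝ),
        ∑ t : Fin s × Fin s × Fin s, (if a = t.2.1 then x else 0) = (s : ℝ) ^ 2 * x :=
      fun a x => by
        rw [Fintype.sum_prod_type]
        simp_rw [Fintype.sum_prod_type_right]
        simp only [Finset.sum_ite_eq, Finset.mem_univ, if_true, Finset.sum_const, Finset.card_univ,
          Fintype.card_fin, nsmul_eq_mul]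
        ring
    have e3 : ∀ (a : Fin s) (x : ℝ),
        ∑ t : Fin s × Fin s × Fin s, (if a = t.2.2 then x else 0) = (s : ℝ) ^ 2 * x :=
      fun a x => by
        simp_rw [Fintype.sum_prod_type]
        simp only [Finset.sum_ite_eq, Finset.mem_univ, if_true, Finset.sum_const, Finset.card_univ,
          Fintype.card_fin, nsmul_eq_mul]
        ring
    simp only [c, Finset.sum_add_distrib, Finset.sum_ite_eq, Finset.mem_univ, if_true, e1, e2, e3,
      Finset.sum_const, Finset.card_univ, Fintype.card_prod, Fintype.card_fin, nsmul_eq_mul]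
    push_cast
    ring
  have hmain := measureReal_iInter_compl_le hA (c := c) (e := (s : ℝ) ^ 3 * (ε / 125))
    (by positivity) ?_ hc
  · rw [hsum] at hmain
    have hset : {ω | ∀ i j l, (X (0, i) ω, X (1, j) ω, X (2, l) ω) ∉ flatTriples ε} =
        ⋂ t, (A t)ᶜ := by
      ext ω
      simp [A]
    rw [hset, ← ENNReal.ofReal_toReal (measure_ne_top P _)]
    refine ENNReal.ofReal_le_ofReal (hmain.trans ?_)
    rw [div_le_iff₀ (by positivity)]
    have h5 : (s : ℝ) ^ 5 * (20 * ε) ^ 2 * s = 400 * 1250000 ^ 2 := by rw [← hsε]; ring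
    have h6 : (s : ℝ) ^ 5 * (20 * ε) ^ 2 * 75000000 ≤ 400 * 1250000 ^ 2 := by
      rw [← h5]; gcongr
    have h7 : ((s : ℝ) ^ 3 * (ε / 125)) = 10000 := by linarith
    rw [h7]
    linarith
  · calc (s : ℝ) ^ 3 * (ε / 125) = ∑ t : Fin s × Fin s × Fin s, ε / 125 := by
          simp only [Finset.sum_const, Finset.card_univ, Fintype.card_prod, Fintype.card_fin,
            nsmul_eq_mul]
          push_cast
          ring
      _ ≤ _ := Finset.sum_le_sum fun t _ => hlow t

theorem minTriangleArea_le {n : ℕ} (x : Fin n → ℝ × ℝ) {i j l : Fin n} (hij : i ≠ j)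
    (hil : i ≠ l) (hjl : j ≠ l) : minTriangleArea x ≤ triangleArea (x i) (x j) (x l) := by
  have key : ∀ {a b c : Fin n}, a < b → b < c →
      minTriangleArea x ≤ triangleArea (x a) (x b) (x c) := fun {a b c} hab hbc =>
    ciInf_le (Set.finite_range _).bddBelow
      (⟨(a, b, c), hab, hbc⟩ : {t : Fin n × Fin n × Fin n // t.1 < t.2.1 ∧ t.2.1 < t.2.2})
  rcases lt_or_gt_of_ne hij with h1 | h1 <;> rcases lt_or_gt_of_ne hil with h2 | h2 <;>
    rcases lt_or_gt_of_ne hjl with h3 | h3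
  · exact key h1 h3
  · rw [← triangleArea_swap_right]; exact key h2 h3
  · exact absurd (h1.trans h3) h2.not_gt
  · rw [← triangleArea_swap_right, ← triangleArea_swap_left]; exact key h2 h1
  · rw [← triangleArea_swap_left]; exact key h1 h2
  · exact absurd (h2.trans h3) h1.not_gt
  · rw [← triangleArea_swap_left, ← triangleArea_swap_right]; exact key h3 h2
  · rw [← triangleArea_swap_left, ← triangleArea_swap_right, ← triangleArea_swap_left]
    exact key h3 h1

/-- If the minimum exceeds the threshold, none of the `k` disjoint blocks of `3 * s` points contains
a flat triple, and the blocks are independent. -/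
theorem measure_lt_minTriangleArea_le_of_blocks {n k s : ℕ} (hs : 75000000 ≤ s)
    (hn : k * (3 * s) ≤ n) {X : Fin n → Ω → ℝ × ℝ} (hX : iIndepFun X P)
    (hm : ∀ i, Measurable (X i)) (hlaw : ∀ i, P.map (X i) = squareMeasure) :
    P {ω | 1250000 / (s : ℝ) ^ 3 < minTriangleArea fun i => X i ω} ≤
      ENNReal.ofReal (1 / 2) ^ k := by
  obtain ⟨f⟩ : Nonempty (Fin k × Fin 3 × Fin s ↪ Fin n) :=
    Function.Embedding.nonempty_of_card_le (by simpa using hn)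
  let D : Set (Fin 3 × Fin s → ℝ × ℝ) :=
    {x | ∀ i j l, (x (0, i), x (1, j), x (2, l)) ∉ flatTriples (1250000 / (s : ℝ) ^ 3)}
  have hD : MeasurableSet D := by
    simp only [D, Set.ofPred_forall]
    exact MeasurableSet.iInter fun i => MeasurableSet.iInter fun j => MeasurableSet.iInter fun l =>
      (measurableSet_flatTriples _).compl.preimage (by fun_prop)
  have hY := hX.precomp f.injective
  have hblock := iIndepFun.measure_forall_block_le hY (fun i => hm (f i)) hD
    (b := ENNReal.ofReal (1 / 2)) (fun g => measure_forall_notMem_flatTriples_le hs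
      (hY.precomp (g := fun t => (g, t)) fun a b h => by simpa using h)
      (fun i => hm _) fun i => hlaw _) Finset.univ
  rw [Finset.card_univ, Fintype.card_fin] at hblock
  refine (measure_mono fun ω hω g _ i j l hmem => ?_).trans hblock
  refine absurd (le_trans (minTriangleArea_le (fun i => X i ω) ?_ ?_ ?_) hmem.2.2.2) hω.not_ge <;>
    exact f.injective.ne (by simp)

end UniformPoints

/-! ### Tail of the minimum and upper bound for its mean -/

section Tail

variable {Ω : Type*} [MeasurableSpace Ω] {P : Measure Ω} [IsProbabilityMeasure P]

theorem ae_mem_unitSquare {P : Measure Ω} {Y : Ω → ℝ × ℝ} (hY : Measurable Y) (hlaw : P.map Y = squareMeasure) :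
    ∀ᵐ ω ∂P, Y ω ∈ unitSquare := by
  refine ae_of_ae_map hY.aemeasurable ?_
  rw [hlaw]
  exact ae_restrict_mem measurableSet_unitSquare

theorem minTriangleArea_nonneg {n : ℕ} (x : Fin n → ℝ × ℝ) : 0 ≤ minTriangleArea x :=
  Real.iInf_nonneg fun _ => triangleArea_nonneg _ _ _

theorem measurable_minTriangleArea {n : ℕ} {X : Fin n → Ω → ℝ × ℝ} (hm : ∀ i, Measurable (X i)) :
    Measurable fun ω => minTriangleArea fun i => X i ω :=
  Measurable.iInf fun _ => measurable_triangleArea (hm _) (hm _) (hm _)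

theorem ae_minTriangleArea_le_one {P : Measure Ω} {n : ℕ} (hn : 3 ≤ n) {X : Fin n → Ω → ℝ × ℝ}
    (hm : ∀ i, Measurable (X i)) (hlaw : ∀ i, P.map (X i) = squareMeasure) :
    ∀ᵐ ω ∂P, minTriangleArea (fun i => X i ω) ≤ 1 := by
  have h : ∀ᵐ ω ∂P, ∀ i, X i ω ∈ unitSquare :=
    ae_all_iff.2 fun i => ae_mem_unitSquare (hm i) (hlaw i)
  filter_upwards [h] with ω hω
  refine (minTriangleArea_le (fun i => X i ω) (i := ⟨0, by omega⟩) (j := ⟨1, by omega⟩)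
    (l := ⟨2, by omega⟩) (by simp) (by simp) (by simp)).trans ?_
  exact triangleArea_le_one (hω _) (hω _) (hω _)

theorem integrable_minTriangleArea {n : ℕ} (hn : 3 ≤ n) {X : Fin n → Ω → ℝ × ℝ}
    (hm : ∀ i, Measurable (X i)) (hlaw : ∀ i, P.map (X i) = squareMeasure) :
    Integrable (fun ω => minTriangleArea fun i => X i ω) P := by
  refine Integrable.of_bound (measurable_minTriangleArea hm).aestronglyMeasurable 1 ?_
  filter_upwards [ae_minTriangleArea_le_one hn hm hlaw] with ω hω
  rwa [Real.norm_eq_abs, abs_of_nonneg (minTriangleArea_nonneg _)]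

theorem measure_lt_minTriangleArea_le {n : ℕ} (hn : 3 ≤ n) {X : Fin n → Ω → ℝ × ℝ}
    (hX : iIndepFun X P) (hm : ∀ i, Measurable (X i))
    (hlaw : ∀ i, P.map (X i) = squareMeasure) (k : ℕ) :
    P {ω | 27 * 75000000 ^ 3 * (k : ℝ) ^ 3 / (n : ℝ) ^ 3 < minTriangleArea fun i => X i ω} ≤
      ENNReal.ofReal (1 / 2) ^ k := by
  rcases Nat.eq_zero_or_pos k with rfl | hk
  · rw [pow_zero]; exact prob_le_one
  have hn0 : (0 : ℝ) < n := by exact_mod_cast (by omega : 0 < n)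
  have hk0 : (0 : ℝ) < k := by exact_mod_cast hk
  by_cases hs : 75000000 ≤ n / (3 * k)
  · set s := n / (3 * k) with hsdef
    have hs0 : (0 : ℝ) < s := by exact_mod_cast (by omega : 0 < s)
    refine (measure_mono fun ω hω => ?_).trans (measure_lt_minTriangleArea_le_of_blocks (k := k)
      hs ?_ hX hm hlaw)
    · refine lt_of_le_of_lt ?_ (Set.mem_ofPred_eq ▸ hω)
      have h1 : n < 3 * k * (s + 1) := Nat.lt_mul_div_succ n (by omega)
      -- Rounding down in `n / (3 * k)` costs at most a factor of two, since `s ≥ 1`.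
      have h2 : n ≤ 6 * k * s := h1.le.trans (by nlinarith)
      have h3 : (n : ℝ) ≤ 6 * k * s := by exact_mod_cast h2
      have h4 : (n : ℝ) ^ 3 ≤ (6 * k * s) ^ 3 := by gcongr
      rw [div_le_div_iff₀ (by positivity) (by positivity)]
      have h5 : (0 : ℝ) ≤ (k : ℝ) ^ 3 * (s : ℝ) ^ 3 := by positivity
      nlinarith
    · calc k * (3 * s) = 3 * k * s := by ring
        _ ≤ n := Nat.mul_div_le _ _
  -- With `n` this small relative to `k`, the threshold is at least `1`, which the minimum almost
  -- surely does not exceed. This case dictates the constant `(3 * 75000000) ^ 3`.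
  · refine le_trans (le_of_eq ?_) zero_le
    rw [not_le, Nat.div_lt_iff_lt_mul (by omega)] at hs
    have h1 : (n : ℝ) ≤ 75000000 * (3 * k) := by exact_mod_cast hs.le
    have h2 : (n : ℝ) ^ 3 ≤ (75000000 * (3 * k)) ^ 3 := by gcongr
    have h3 : 1 ≤ 27 * 75000000 ^ 3 * (k : ℝ) ^ 3 / (n : ℝ) ^ 3 := by
      rw [one_le_div (by positivity)]
      exact h2.trans (le_of_eq (by ring))
    rw [← nonpos_iff_eq_zero]
    refine le_of_le_of_eq (measure_mono_ae ?_) (measure_empty (μ := P))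
    filter_upwards [ae_minTriangleArea_le_one hn hm hlaw] with ω hω h
    exact absurd (h3.trans_lt h) hω.not_gt

/-- Layers between consecutive cubes: where `a * j ^ 3 < f ≤ a * (j + 1) ^ 3`, the `j`-th term of
the sum of indicators already dominates `f`. -/
theorem lintegral_le_of_cube_tail {P : Measure Ω} {f : Ω → ℝ} (hf : Measurable f) {a : ℝ} (ha : 0 < a)
    (h : ∀ k : ℕ, P {ω | a * (k : ℝ) ^ 3 < f ω} ≤ ENNReal.ofReal (1 / 2) ^ k) :
    ∫⁻ ω, ENNReal.ofReal (f ω) ∂P ≤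
      ENNReal.ofReal (a * ∑' k : ℕ, ((k : ℝ) + 1) ^ 3 * (1 / 2) ^ k) := by
  have hmeas : ∀ k : ℕ, MeasurableSet {ω | a * (k : ℝ) ^ 3 < f ω} := fun k =>
    measurableSet_lt measurable_const hf
  have hsum : Summable fun k : ℕ => ((k : ℝ) + 1) ^ 3 * (1 / 2) ^ k := by
    have h1 := (summable_nat_add_iff 1).2
      (summable_pow_mul_geometric_of_norm_lt_one 3 (r := (1 / 2 : ℝ)) (by norm_num))
    refine (h1.mul_left 2).congr fun k => ?_
    push_cast
    ring
  have hpt : ∀ ω, ENNReal.ofReal (f ω) ≤ ∑' k : ℕ, {ω | a * (k : ℝ) ^ 3 < f ω}.indicator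
      (fun _ => ENNReal.ofReal (a * ((k : ℝ) + 1) ^ 3)) ω := fun ω => by
    rcases le_or_gt (f ω) 0 with h0 | h0
    · rw [ENNReal.ofReal_of_nonpos h0]; exact zero_le
    have hex : ∃ k : ℕ, f ω ≤ a * (k : ℝ) ^ 3 := by
      obtain ⟨k, hk⟩ := exists_nat_ge (f ω / a + 1)
      refine ⟨k, ?_⟩
      have h1 : (1 : ℝ) ≤ k := by
        have : 0 < f ω / a := div_pos h0 ha
        linarith
      have h2 : (k : ℝ) ≤ (k : ℝ) ^ 3 := le_self_pow₀ h1 (by norm_num)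
      rw [← div_le_iff₀' ha]
      linarith
    classical
    obtain ⟨j, hj⟩ : ∃ j, Nat.find hex = j + 1 := Nat.exists_eq_succ_of_ne_zero fun hz => by
      have := Nat.find_spec hex
      rw [hz] at this
      norm_num at this
      linarith
    have h1 : a * (j : ℝ) ^ 3 < f ω := not_le.1 (Nat.find_min hex (by omega))
    have h2 : f ω ≤ a * ((j : ℝ) + 1) ^ 3 := by
      have := Nat.find_spec hex
      rw [hj] at this
      exact_mod_cast this
    refine le_trans ?_ (ENNReal.le_tsum j)
    rw [Set.indicator_of_mem (by exact h1)]
    exact ENNReal.ofReal_le_ofReal h2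
  calc ∫⁻ ω, ENNReal.ofReal (f ω) ∂P
      ≤ ∫⁻ ω, ∑' k : ℕ, {ω | a * (k : ℝ) ^ 3 < f ω}.indicator
          (fun _ => ENNReal.ofReal (a * ((k : ℝ) + 1) ^ 3)) ω ∂P := lintegral_mono hpt
    _ = ∑' k : ℕ, ENNReal.ofReal (a * ((k : ℝ) + 1) ^ 3) * P {ω | a * (k : ℝ) ^ 3 < f ω} := by
        rw [lintegral_tsum fun k => (measurable_const.indicator (hmeas k)).aemeasurable]
        exact tsum_congr fun k => lintegral_indicator_const (hmeas k) _
    _ ≤ ∑' k : ℕ, ENNReal.ofReal (a * (((k : ℝ) + 1) ^ 3 * (1 / 2) ^ k)) := by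
        refine ENNReal.tsum_le_tsum fun k => ?_
        rw [← mul_assoc, ENNReal.ofReal_mul (p := a * ((k : ℝ) + 1) ^ 3) (by positivity),
          ENNReal.ofReal_pow (by norm_num)]
        exact mul_le_mul' le_rfl (h k)
    _ = _ := by
        rw [← tsum_mul_left, ENNReal.ofReal_tsum_of_nonneg (fun k => by positivity)
          (hsum.mul_left a)]

theorem integral_minTriangleArea_le {n : ℕ} (hn : 3 ≤ n) {X : Fin n → Ω → ℝ × ℝ}
    (hX : iIndepFun X P) (hm : ∀ i, Measurable (X i))
    (hlaw : ∀ i, P.map (X i) = squareMeasure) :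
    ∫ ω, minTriangleArea (fun i => X i ω) ∂P ≤
      27 * 75000000 ^ 3 * (∑' k : ℕ, ((k : ℝ) + 1) ^ 3 * (1 / 2) ^ k) / (n : ℝ) ^ 3 := by
  have hn0 : (0 : ℝ) < n := by exact_mod_cast (by omega : 0 < n)
  have hT : 0 ≤ ∑' k : ℕ, ((k : ℝ) + 1) ^ 3 * (1 / 2) ^ k := tsum_nonneg fun k => by positivity
  have h := lintegral_le_of_cube_tail (P := P) (measurable_minTriangleArea hm)
    (a := 27 * 75000000 ^ 3 / (n : ℝ) ^ 3) (by positivity) fun k => by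
      rw [div_mul_eq_mul_div]
      exact measure_lt_minTriangleArea_le hn hX hm hlaw k
  rw [integral_eq_lintegral_of_nonneg_ae
    (Filter.Eventually.of_forall fun ω => minTriangleArea_nonneg _)
    (measurable_minTriangleArea hm).aestronglyMeasurable]
  refine ENNReal.toReal_le_of_le_ofReal (by positivity) (h.trans (le_of_eq ?_))
  rw [div_mul_eq_mul_div]

/-! ### Lower bound for the mean -/

/-- Dyadic integration of `4 * ε / dist q p`: on the shell `2⁻⁽ᵏ⁺¹⁾ < dist q p ≤ 2⁻ᵏ` it is at most
`8 * ε * 2 ^ k`, and the enclosing ball has measure at most `4 * 4⁻ᵏ`. The terms `32 * ε * 2⁻ᵏ` sum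
to `64 * ε`. -/
theorem lintegral_squareMeasure_triangleArea_le {p : ℝ × ℝ} (hp : p ∈ unitSquare) {ε : ℝ}
    (hε : 0 ≤ ε) :
    ∫⁻ q, squareMeasure {r | triangleArea p q r ≤ ε} ∂squareMeasure ≤ ENNReal.ofReal (64 * ε) := by
  have hpt : ∀ᵐ q ∂squareMeasure, squareMeasure {r | triangleArea p q r ≤ ε} ≤
      ∑' k : ℕ, (Metric.closedBall p ((1 / 2) ^ k)).indicator
        (fun _ => ENNReal.ofReal (8 * ε * 2 ^ k)) q := by
    have h1 : ∀ᵐ q ∂squareMeasure, q ≠ p := by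
      rw [ae_iff]
      simp only [ne_eq, not_not, Set.ofPred_eq_eq_singleton]
      exact nonpos_iff_eq_zero.1 ((Measure.restrict_apply_le _ _).trans (by simp))
    filter_upwards [h1, ae_restrict_mem measurableSet_unitSquare] with q hq hqs
    have hd : 0 < dist q p := dist_pos.2 hq
    have hd1 : dist q p ≤ 1 := by
      obtain ⟨⟨a, b⟩, c, d⟩ := hp
      obtain ⟨⟨a', b'⟩, c', d'⟩ := hqs
      rw [Prod.dist_eq, Real.dist_eq, Real.dist_eq]
      exact max_le (abs_le.2 ⟨by linarith, by linarith⟩) (abs_le.2 ⟨by linarith, by linarith⟩)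
    obtain ⟨k, hk1, hk2⟩ := exists_nat_pow_near_of_lt_one hd hd1
      (y := (1 / 2 : ℝ)) (by norm_num) (by norm_num)
    refine (squareMeasure_triangleArea_le_dist hq.symm ε).trans (le_trans ?_ (ENNReal.le_tsum k))
    rw [Set.indicator_of_mem (Metric.mem_closedBall.2 hk2)]
    refine ENNReal.ofReal_le_ofReal ?_
    rw [div_le_iff₀ hd]
    have h2 : (1 : ℝ) ≤ 2 * 2 ^ k * dist q p := by
      have h3 : (2 * 2 ^ k : ℝ) * (1 / 2) ^ (k + 1) = 1 := by
        rw [pow_succ, one_div, inv_pow]; field_simp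
      rw [← h3]
      gcongr
    nlinarith
  have hterm : ∀ k : ℕ, ENNReal.ofReal (8 * ε * 2 ^ k) *
      squareMeasure (Metric.closedBall p ((1 / 2) ^ k)) ≤
        ENNReal.ofReal (32 * ε * (1 / 2) ^ k) := fun k => by
    refine (mul_le_mul' le_rfl (squareMeasure_closedBall_le p (by positivity))).trans
      (le_of_eq ?_)
    rw [← ENNReal.ofReal_mul (by positivity)]
    congr 1
    rw [one_div, inv_pow]
    field_simp
    ring
  calc ∫⁻ q, squareMeasure {r | triangleArea p q r ≤ ε} ∂squareMeasure
      ≤ ∫⁻ q, ∑' k : ℕ, (Metric.closedBall p ((1 / 2) ^ k)).indicator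
        (fun _ => ENNReal.ofReal (8 * ε * 2 ^ k)) q ∂squareMeasure := lintegral_mono_ae hpt
    _ = ∑' k : ℕ, ENNReal.ofReal (8 * ε * 2 ^ k) *
          squareMeasure (Metric.closedBall p ((1 / 2) ^ k)) := by
        rw [lintegral_tsum fun k =>
          (measurable_const.indicator Metric.isClosed_closedBall.measurableSet).aemeasurable]
        exact tsum_congr fun k =>
          lintegral_indicator_const Metric.isClosed_closedBall.measurableSet _
    _ ≤ ∑' k : ℕ, ENNReal.ofReal (32 * ε * (1 / 2) ^ k) := ENNReal.tsum_le_tsum hterm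
    _ = ENNReal.ofReal (64 * ε) := by
        rw [← ENNReal.ofReal_tsum_of_nonneg (fun k => by positivity)
          (summable_geometric_two.mul_left _), tsum_mul_left, tsum_geometric_two]
        congr 1; ring

theorem measure_triangleArea_le {n : ℕ} {X : Fin n → Ω → ℝ × ℝ}
    (hX : iIndepFun X P) (hm : ∀ i, Measurable (X i))
    (hlaw : ∀ i, P.map (X i) = squareMeasure) {i j l : Fin n} (hij : i ≠ j) (hil : i ≠ l)
    (hjl : j ≠ l) {ε : ℝ} (hε : 0 ≤ ε) :
    P {ω | triangleArea (X i ω) (X j ω) (X l ω) ≤ ε} ≤ ENNReal.ofReal (64 * ε) := by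
  have hE : MeasurableSet {w : (ℝ × ℝ) × (ℝ × ℝ) × (ℝ × ℝ) |
      triangleArea w.1 w.2.1 w.2.2 ≤ ε} :=
    measurableSet_le (measurable_triangleArea (by fun_prop) (by fun_prop) (by fun_prop))
      measurable_const
  have hmap : P.map (fun ω => (X j ω, X l ω)) = squareMeasure.prod squareMeasure := by
    rw [(indepFun_iff_map_prod_eq_prod_map_map (hm j).aemeasurable (hm l).aemeasurable).1
      (hX.indepFun hjl), hlaw, hlaw]
  have h1 := (hX.indepFun_prodMk hm j l i hij.symm hil.symm).symm.measure_and_le (hm i)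
    ((hm j).prodMk (hm l)) measurableSet_unitSquare hE (b := ENNReal.ofReal (64 * ε))
    (fun p hp => by
      rw [hmap]
      refine (Measure.prod_apply (hE.preimage measurable_prodMk_left)).le.trans ?_
      exact lintegral_squareMeasure_triangleArea_le hp hε)
  refine le_trans (measure_mono_ae ?_) (h1.trans (mul_le_of_le_one_right zero_le prob_le_one))
  filter_upwards [ae_mem_unitSquare (hm i) (hlaw i)] with ω hω h
  exact ⟨hω, h⟩

theorem measure_minTriangleArea_le {n : ℕ} (hn : 3 ≤ n) {X : Fin n → Ω → ℝ × ℝ}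
    (hX : iIndepFun X P) (hm : ∀ i, Measurable (X i))
    (hlaw : ∀ i, P.map (X i) = squareMeasure) {ε : ℝ} (hε : 0 ≤ ε) :
    P {ω | minTriangleArea (fun i => X i ω) ≤ ε} ≤ ENNReal.ofReal ((n : ℝ) ^ 3 * (64 * ε)) := by
  let τ := {t : Fin n × Fin n × Fin n // t.1 < t.2.1 ∧ t.2.1 < t.2.2}
  have : Nonempty τ := ⟨⟨(⟨0, by omega⟩, ⟨1, by omega⟩, ⟨2, by omega⟩), by simp⟩⟩
  calc P {ω | minTriangleArea (fun i => X i ω) ≤ ε}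
      ≤ P (⋃ t : τ, {ω | triangleArea (X t.1.1 ω) (X t.1.2.1 ω) (X t.1.2.2 ω) ≤ ε}) := by
        refine measure_mono fun ω hω => ?_
        obtain ⟨t, ht⟩ := exists_eq_ciInf_of_finite
          (f := fun t : τ => triangleArea (X t.1.1 ω) (X t.1.2.1 ω) (X t.1.2.2 ω))
        exact Set.mem_iUnion.2 ⟨t, ht.le.trans hω⟩
    _ ≤ ∑ t : τ, P {ω | triangleArea (X t.1.1 ω) (X t.1.2.1 ω) (X t.1.2.2 ω) ≤ ε} :=
        measure_iUnion_fintype_le _ _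
    _ ≤ ∑ t : τ, ENNReal.ofReal (64 * ε) := Finset.sum_le_sum fun t _ =>
        measure_triangleArea_le hX hm hlaw t.2.1.ne (t.2.1.trans t.2.2).ne t.2.2.ne hε
    _ = (Fintype.card τ : ENNReal) * ENNReal.ofReal (64 * ε) := by simp
    _ ≤ ((n ^ 3 : ℕ) : ENNReal) * ENNReal.ofReal (64 * ε) := by
        gcongr
        refine (Fintype.card_subtype_le _).trans (le_of_eq ?_)
        simp only [Fintype.card_prod, Fintype.card_fin]
        ring
    _ = _ := by
        rw [← ENNReal.ofReal_natCast, ← ENNReal.ofReal_mul (by positivity)]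
        push_cast
        rfl

theorem le_integral_minTriangleArea {n : ℕ} (hn : 3 ≤ n) {X : Fin n → Ω → ℝ × ℝ}
    (hX : iIndepFun X P) (hm : ∀ i, Measurable (X i))
    (hlaw : ∀ i, P.map (X i) = squareMeasure) :
    1 / 256 / (n : ℝ) ^ 3 ≤ ∫ ω, minTriangleArea (fun i => X i ω) ∂P := by
  have hn0 : (0 : ℝ) < n := by exact_mod_cast (by omega : 0 < n)
  -- Chosen so that the union bound `n ^ 3 * (64 * ε)` equals `1 / 2`.
  set ε : ℝ := 1 / 128 / (n : ℝ) ^ 3 with hεdef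
  have hε : 0 < ε := by positivity
  have hlow : P.real {ω | minTriangleArea (fun i => X i ω) ≤ ε} ≤ 1 / 2 := by
    refine ENNReal.toReal_le_of_le_ofReal (by norm_num)
      ((measure_minTriangleArea_le hn hX hm hlaw hε.le).trans (le_of_eq ?_))
    congr 1
    rw [hεdef]
    field_simp
    norm_num
  have hmeas : MeasurableSet {ω | minTriangleArea (fun i => X i ω) ≤ ε} :=
    measurableSet_le (measurable_minTriangleArea hm) measurable_const
  have hhigh : 1 / 2 ≤ P.real {ω | ε ≤ minTriangleArea (fun i => X i ω)} := by
    have h1 := probReal_compl_eq_one_sub (μ := P) hmeas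
    have h2 : P.real {ω | minTriangleArea (fun i => X i ω) ≤ ε}ᶜ ≤
        P.real {ω | ε ≤ minTriangleArea (fun i => X i ω)} :=
      measureReal_mono fun ω (hω : ¬ _ ≤ ε) => (not_le.1 hω).le
    linarith
  have hmarkov := mul_meas_ge_le_integral_of_nonneg
    (Filter.Eventually.of_forall fun ω => minTriangleArea_nonneg fun i => X i ω)
    (integrable_minTriangleArea hn hm hlaw) ε
  refine le_trans ?_ hmarkov
  calc 1 / 256 / (n : ℝ) ^ 3 = ε * (1 / 2) := by rw [hεdef]; ring
    _ ≤ _ := by gcongr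

end Tail

/-! ### Main theorem -/

theorem mainTheorem6 :
    ∃ c C : ℝ, 0 < c ∧ 0 < C ∧
      ∀ n : ℕ, 3 ≤ n →
        ∀ (Ω : Type*) [MeasurableSpace Ω] (P : Measure Ω) [IsProbabilityMeasure P]
          (X : Fin n → Ω → ℝ × ℝ),
          (∀ i, AEMeasurable (X i) P) →
          iIndepFun X P →
          (∀ i, pdf.IsUniform (X i) unitSquare P volume) →
            Integrable (fun ω => minTriangleArea (fun i => X i ω)) P ∧
            c / (n : ℝ) ^ 3 < ∫ ω, minTriangleArea (fun i => X i ω) ∂P ∧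
            ∫ ω, minTriangleArea (fun i => X i ω) ∂P < C / (n : ℝ) ^ 3 := by
  have hT : 0 ≤ ∑' k : ℕ, ((k : ℝ) + 1) ^ 3 * (1 / 2) ^ k := tsum_nonneg fun k => by positivity
  -- Halving `1 / 256` and adding `1` turn the two weak bounds into strict ones.
  refine ⟨1 / 512, 27 * 75000000 ^ 3 * (∑' k : ℕ, ((k : ℝ) + 1) ^ 3 * (1 / 2) ^ k) + 1,
    by norm_num, by positivity, ?_⟩
  intro n hn Ω _ P _ X hXm hX hunif
  have hn0 : (0 : ℝ) < n := by exact_mod_cast (by omega : 0 < n)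
  -- Measurable versions of the points; independence, laws and the integral are unchanged almost
  -- everywhere.
  let Y : Fin n → Ω → ℝ × ℝ := fun i => (hXm i).mk
  have hXY : ∀ i, X i =ᵐ[P] Y i := fun i => (hXm i).ae_eq_mk
  have hm : ∀ i, Measurable (Y i) := fun i => (hXm i).measurable_mk
  have hY : iIndepFun Y P := hX.congr hXY
  have hlaw : ∀ i, P.map (Y i) = squareMeasure := fun i => by
    rw [← Measure.map_congr (hXY i), hunif i, ProbabilityTheory.cond, volume_unitSquare, inv_one,
      one_smul]
  have hae : (fun ω => minTriangleArea fun i => X i ω) =ᵐ[P]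
      fun ω => minTriangleArea fun i => Y i ω := by
    filter_upwards [ae_all_iff.2 hXY] with ω hω
    simp only [hω]
  refine ⟨(integrable_minTriangleArea hn hm hlaw).congr hae.symm, ?_, ?_⟩ <;>
    rw [integral_congr_ae hae]
  · refine lt_of_lt_of_le ?_ (le_integral_minTriangleArea hn hY hm hlaw)
    gcongr
    norm_num
  · refine lt_of_le_of_lt (integral_minTriangleArea_le hn hY hm hlaw) ?_
    gcongr
    exact lt_add_one _
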